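/- An analytic space is a metrizable topological space that is a continuous image of the irrationals (equivalently, of $\mathbb{N}^{\mathbb{N}}$). For a topological space $E$, let $F(E)$ be the set of all closed subsets of $E$, and let the Effros Borel structure $\mathscr{B}_{F(E)}$ be the $\sigma$-algebra on $F(E)$ generated by the sets $\{A \in F(E) : A \cap U \neq \emptyset\}$ with $U$ open in $E$. A set $\mathscr{A} \subseteq F(E)$ is a Souslin set in $(F(E), \mathscr{B}_{F(E)})$ if it is a result of the Souslin operation on sets from $\mathscr{B}_{F(E)}$, i.e. there are $P_s \in \mathscr{B}_{F(E)}$, indexed by the finite sequences $s$ of natural numbers, with $\mathscr{A} = \bigcup_{x \in \mathbb{N}^{\mathbb{N}}} \bigcap_{n \in \mathbb{N}} P_{(x_0, \dots, x_{n-1})}$. **Proposition 3.1.** Let $f : E \to F$ be a continuous map of an analytic space $E$ onto a metrizable space $F$ that is not $\sigma$-compact. Then there exists a set $S \subseteq E$ that is relatively discrete (i.e. discrete in the subspace topology) such that, for every Souslin set $\mathscr{A}$ in $(F(E), \mathscr{B}_{F(E)})$ that contains as elements all subsets of $S$ that are closed in $E$, there are $A \in \mathscr{A}$ and $y \in F$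 with $f^{-1}(y) \subseteq A$. -/

import Mathlib

/-- The Effros Borel structure on the space `F(E)` of closed subsets of `E`: the `σ`-algebra
generated by the sets `{A ∈ F(E) : A ∩ U ≠ ∅}`, where `U` is open in `E`. -/
abbrev effrosBorel (E : Type*) [TopologicalSpace E] :
    MeasurableSpace (TopologicalSpace.Closeds E) :=
  MeasurableSpace.generateFrom
    {𝒰 | ∃ U : Set E, IsOpen U ∧
      𝒰 = {A : TopologicalSpace.Closeds E | ((A : Set E) ∩ U).Nonempty}}

/-- The Souslin operation: from a family `P` of sets indexed by the finite sequences of natural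
numbers, form the union over all `x : ℕ → ℕ` of the intersections over `n` of the sets
`P (x 0, …, x (n - 1))`. -/
def souslinOperation {α : Type*} (P : List ℕ → Set α) : Set α :=
  ⋃ x : ℕ → ℕ, ⋂ n : ℕ, P (List.ofFn fun i : Fin n => x i)

/-- A set in a measurable space `(α, m)` is Souslin if it is a result of the Souslin operation on
measurable sets. -/
def IsSouslin {α : Type*} (m : MeasurableSpace α) (𝒜 : Set α) : Prop :=
  ∃ P : List ℕ → Set α, (∀ s, @MeasurableSet α m (P s)) ∧ 𝒜 = souslinOperation P

open Set Filter Topology TopologicalSpace MeasureTheory PiNat Encodable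

/-! Take for `S` the range of points `x s` of `E`, indexed by finite sequences, with `f (x s)` in
nested sets `H s` of `F` such that the children of each node form a discrete family. Over a
well-founded tree `T` the points `f (x s)` are locally finite (`exists_nhds_finite_of_wellFounded`),
so `x '' T` is closed and belongs to `𝒜`. Since `T ↦ closure (x '' T)` is Borel, the `T` sent into
`𝒜` form an analytic set, and by `MeasureTheory.AnalyticSet.exists_illfounded_tree` one of them
contains an infinite branch.

`exists_scheme` arranges that each branch has a `y` such that its points enter every basic open set
meeting `f ⁻¹' {y}`; this fibre then lies in the closure of the branch. Failure of `σ`-compactness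
yields a closed set of parameters on which all nonempty open sets have large images, so every node
can be split into infinitely many children. -/

/-! ### Diagonalization against analytic sets of trees -/

/-- The set of finite sequences `s` that extend to some `α` for which `g α` agrees, on the
sequences with code below the length of `s`, with the set being defined. Sequences are stored with
their last entry first. -/
def diagonalTree (g : (ℕ → ℕ) → List ℕ → Bool) (s : List ℕ) : Prop :=
  ∃ α : ℕ → ℕ, res α s.length = s ∧
    ∀ t : List ℕ, encode t < s.length → (g α t = true ↔ diagonalTree g t)
termination_by encode s
decreasing_by exact lt_of_lt_of_le ‹_› (length_le_encode _)

theorem diagonalTree_iff (g : (ℕ → ℕ) → List ℕ → Bool) (s : List ℕ) :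
    diagonalTree g s ↔ ∃ α : ℕ → ℕ, res α s.length = s ∧
      ∀ t : List ℕ, encode t < s.length → (g α t = true ↔ diagonalTree g t) := by
  rw [diagonalTree]

theorem diagonalTree_of_cons {g : (ℕ → ℕ) → List ℕ → Bool} {k : ℕ} {s : List ℕ}
    (h : diagonalTree g (k :: s)) : diagonalTree g s := by
  rw [diagonalTree_iff] at h ⊢
  obtain ⟨α, hα, hg⟩ := h
  rw [List.length_cons, res_succ, List.cons.injEq] at hα
  exact ⟨α, hα.2, fun t ht ↦ hg t (ht.trans (Nat.lt_succ_self _))⟩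

/-- An analytic set of trees that contains all well-founded trees contains an ill-founded one. -/
theorem MeasureTheory.AnalyticSet.exists_illfounded_tree {B : Set (List ℕ → Bool)}
    (hB : AnalyticSet B)
    (hwf : ∀ T : List ℕ → Bool, (∀ k s, T (k :: s) = true → T s = true) →
      (∀ α : ℕ → ℕ, ∃ n, T (res α n) = false) → T ∈ B) :
    ∃ T ∈ B, ∃ α : ℕ → ℕ, ∀ n, T (res α n) = true := by
  classical
  rw [AnalyticSet] at hB
  rcases hB with rfl | ⟨g, hg, rfl⟩
  · exact absurd (hwf (fun _ ↦ false) (by simp) (by simp)) (notMem_empty _)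
  by_cases hbr : ∃ α : ℕ → ℕ, ∀ n, diagonalTree g (res α n)
  · obtain ⟨α, hα⟩ := hbr
    have key : ∀ n, ∃ β : ℕ → ℕ, res β n = res α n ∧
        ∀ t : List ℕ, encode t < n → (g β t = true ↔ diagonalTree g t) := fun n ↦ by
      simpa only [res_length] using (diagonalTree_iff g _).1 (hα n)
    choose β hβ hgβ using key
    have hlim : Tendsto β atTop (𝓝 α) := by
      refine tendsto_pi_nhds.2 fun i ↦ tendsto_const_nhds.congr' ?_
      filter_upwards [eventually_gt_atTop i] with n hn
      exact ((res_eq_res.1 (hβ n)) hn).symm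
    -- By continuity of `g` the finite agreements pass to the limit: `g α` is the diagonal tree
    -- itself.
    have hT : ∀ t, g α t = true ↔ diagonalTree g t := fun t ↦ by
      have h1 : Tendsto (fun n ↦ g (β n) t) atTop (𝓝 (g α t)) :=
        (tendsto_pi_nhds.1 ((hg.tendsto α).comp hlim)) t
      rw [nhds_discrete, tendsto_pure] at h1
      obtain ⟨n, hn, hn'⟩ := (h1.and (eventually_gt_atTop (encode t))).exists
      rw [← hn]
      exact hgβ n t hn'
    exact ⟨g α, mem_range_self α, α, fun n ↦ (hT _).2 (hα n)⟩
  · push Not at hbr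
    -- A diagonal tree without branches is some `g α`; but then `α` witnesses that all its own
    -- initial segments lie in the tree.
    obtain ⟨α, hα⟩ := hwf (fun s ↦ decide (diagonalTree g s))
      (fun k s h ↦ by simpa using diagonalTree_of_cons (by simpa using h))
      (fun α ↦ by simpa using hbr α)
    obtain ⟨n, hn⟩ := hbr α
    refine absurd ((diagonalTree_iff g _).2 ⟨α, by rw [res_length], fun t _ ↦ ?_⟩) hn
    rw [hα]
    exact decide_eq_true_iff

/-! ### Souslin sets and the Effros structure -/

/-- The Souslin operation, applied to Borel subsets of a Polish space, yields an analytic set. -/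
theorem IsSouslin.analyticSet {X : Type*} [TopologicalSpace X] [PolishSpace X]
    [m : MeasurableSpace X] [BorelSpace X] {A : Set X} (hA : IsSouslin m A) : AnalyticSet A := by
  obtain ⟨P, hP, rfl⟩ := hA
  have hpre : ∀ (n : ℕ) (s : List ℕ),
      MeasurableSet {x : ℕ → ℕ | List.ofFn (fun i : Fin n ↦ x i) = s} := fun n s ↦
    (measurable_pi_lambda (fun (x : ℕ → ℕ) (i : Fin n) ↦ x i) fun i ↦ measurable_pi_apply _)
      (MeasurableSet.of_discrete (s := {y : Fin n → ℕ | List.ofFn y = s}))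
  -- The Souslin operation is the projection of this Borel set.
  have hmeas : MeasurableSet {q : X × (ℕ → ℕ) | ∀ n, q.1 ∈ P (List.ofFn fun i : Fin n ↦ q.2 i)} := by
    have : {q : X × (ℕ → ℕ) | ∀ n, q.1 ∈ P (List.ofFn fun i : Fin n ↦ q.2 i)} =
        ⋂ n : ℕ, ⋃ s : List ℕ, P s ×ˢ {x : ℕ → ℕ | List.ofFn (fun i : Fin n ↦ x i) = s} := by
      ext q
      simp
    rw [this]
    exact .iInter fun n ↦ .iUnion fun s ↦ (hP s).prod (hpre n s)
  convert hmeas.analyticSet_image measurable_fst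
  ext q
  simp [souslinOperation]

theorem IsSouslin.preimage {α β : Type*} {m : MeasurableSpace α} {m' : MeasurableSpace β}
    {φ : α → β} (hφ : Measurable φ) {A : Set β} (hA : IsSouslin m' A) : IsSouslin m (φ ⁻¹' A) := by
  obtain ⟨P, hP, rfl⟩ := hA
  exact ⟨fun s ↦ φ ⁻¹' P s, fun s ↦ hφ (hP s), by simp [souslinOperation, preimage_iInter]⟩

/-- The closure of `{x s : T s}` depends on `T` in a Borel way. -/
theorem measurable_closure_image {ι E : Type*} [Countable ι] [TopologicalSpace E] (x : ι → E) :
    Measurable[MeasurableSpace.pi, effrosBorel E]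
      fun T : ι → Bool ↦ Closeds.closure (x '' {s | T s = true}) := by
  refine @measurable_generateFrom _ _ MeasurableSpace.pi _ _ ?_
  rintro _ ⟨U, hU, rfl⟩
  have : (fun T : ι → Bool ↦ Closeds.closure (x '' {s | T s = true})) ⁻¹'
      {A : Closeds E | ((A : Set E) ∩ U).Nonempty} = ⋃ s ∈ x ⁻¹' U, {T : ι → Bool | T s = true} := by
    ext T
    simp only [mem_preimage, mem_ofPred_eq, Closeds.coe_closure,
      closure_inter_open_nonempty_iff hU, mem_iUnion, exists_prop]
    constructor
    · rintro ⟨_, ⟨s, hs, rfl⟩, hU⟩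
      exact ⟨s, hU, hs⟩
    · rintro ⟨s, hU, hs⟩
      exact ⟨_, ⟨s, hs, rfl⟩, hU⟩
  rw [this]
  exact .biUnion (to_countable _) fun s _ ↦ measurableSet_eq_fun (measurable_pi_apply s) measurable_const

/-! ### Discrete families of open sets -/

/-- A sequence in the closure without cluster points can be perturbed into `A`. Each value recurs
finitely often, so the range is infinite and can be enumerated injectively. The radius depends on
`y`. -/
theorem exists_uniformly_discrete_seq {F : Type*} [MetricSpace F] {A : Set F}
    (hA : ¬ IsCompact (closure A)) :
    ∃ d : ℕ → F, (∀ n, d n ∈ A) ∧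
      ∀ y, ∃ ε > 0, ∀ n m, dist (d n) y < ε → dist (d m) y < ε → n = m := by
  obtain ⟨u, huA, hu⟩ : ∃ u : ℕ → F, (∀ n, u n ∈ A) ∧ ∀ y, ¬ MapClusterPt y atTop u := by
    by_contra! hcon
    refine hA (IsSeqCompact.isCompact fun v hv ↦ ?_)
    have hpert : ∀ n : ℕ, ∃ a ∈ A, dist (v n) a < 1 / (n + 1 : ℝ) := fun n ↦
      Metric.mem_closure_iff.1 (hv n) _ (by positivity)
    choose u huA huv using hpert
    obtain ⟨y, hy⟩ := hcon u huA
    obtain ⟨ψ, hψ, hlim⟩ := hy.tendsto_subseq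
    have hd : Tendsto (fun n ↦ dist (v n) (u n)) atTop (𝓝 0) :=
      squeeze_zero (fun _ ↦ dist_nonneg) (fun n ↦ (huv n).le) tendsto_one_div_add_atTop_nhds_zero_nat
    have hlim' : Tendsto (v ∘ ψ) atTop (𝓝 y) :=
      (tendsto_iff_of_dist (hd.comp hψ.tendsto_atTop)).2 hlim
    exact ⟨y, mem_closure_of_tendsto hlim (.of_forall fun n ↦ huA _), ψ, hψ, hlim'⟩
  have hfin : ∀ y, ∃ ε > 0, {n | dist (u n) y < ε}.Finite := fun y ↦ by
    have := hu y
    rw [mapClusterPt_iff_frequently] at this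
    push Not at this
    obtain ⟨s, hs, hn⟩ := this
    obtain ⟨ε, hε, hb⟩ := Metric.mem_nhds_iff.1 hs
    refine ⟨ε, hε, ?_⟩
    rw [← Nat.cofinite_eq_atTop] at hn
    exact (eventually_cofinite.1 hn).subset fun n hn' ↦ not_not.2 (hb hn')
  have hinf : (range u).Infinite := fun hr ↦ by
    have hcover : (univ : Set ℕ) ⊆ ⋃ y ∈ range u, {n | u n = y} := fun n _ ↦ by simp
    refine infinite_univ ((hr.biUnion fun y _ ↦ ?_).subset hcover)
    obtain ⟨ε, hε, h⟩ := hfin y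
    exact h.subset fun n (hn : u n = y) ↦ by simpa [hn] using hε
  let d := hinf.natEmbedding
  refine ⟨fun n ↦ d n, fun n ↦ ?_, fun y ↦ ?_⟩
  · obtain ⟨k, hk⟩ := (d n).2
    change (d n : F) ∈ A
    rw [← hk]
    exact huA k
  · obtain ⟨ε, hε, h⟩ := hfin y
    have hN : ((u '' {n | dist (u n) y < ε}) \ {y})ᶜ ∈ 𝓝 y :=
      ((h.image u).subset sdiff_subset).isClosed.isOpen_compl.mem_nhds (by simp)
    obtain ⟨δ, hδ, hb⟩ := Metric.mem_nhds_iff.1 hN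
    have key : ∀ n, dist (d n : F) y < min ε δ → (d n : F) = y := fun n hn ↦ by
      by_contra hne
      obtain ⟨k, hk⟩ := (d n).2
      refine hb (Metric.mem_ball.2 (hn.trans_le (min_le_right _ _))) ⟨⟨k, ?_, hk⟩, hne⟩
      change dist (u k) y < ε
      rw [hk]
      exact hn.trans_le (min_le_left _ _)
    exact ⟨min ε δ, lt_min hε hδ, fun n m hn hm ↦
      d.injective (Subtype.ext ((key n hn).trans (key m hm).symm))⟩

/-- A set with noncompact closure meets every member of an infinite discrete family of open
sets. -/
theorem exists_discrete_open_family {F : Type*} [TopologicalSpace F] [MetrizableSpace F] {A : Set F}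
    (hA : ¬ IsCompact (closure A)) :
    ∃ W : ℕ → Set F, (∀ n, IsOpen (W n)) ∧ (∀ n, (A ∩ W n).Nonempty) ∧
      ∀ y, ∃ O ∈ 𝓝 y, ∀ n m, (O ∩ W n).Nonempty → (O ∩ W m).Nonempty → n = m := by
  let := metrizableSpaceMetric F
  obtain ⟨d, hdA, hd⟩ := exists_uniformly_discrete_seq hA
  choose ε hε hdε using hd
  have hsep : ∀ n m, n ≠ m → ε (d n) ≤ dist (d n) (d m) := fun n m hnm ↦ by
    by_contra! h
    exact hnm (hdε (d n) n m (by simpa using hε _) (by rwa [dist_comm]))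
  -- If the ball about `y` meets the balls of `n ≠ m`, the separation forces `dist (d n) (d m) < ε
  -- y`, and then both centres are within `ε y` of `y`.
  refine ⟨fun n ↦ Metric.ball (d n) (ε (d n) / 3), fun n ↦ Metric.isOpen_ball,
    fun n ↦ ⟨d n, hdA n, Metric.mem_ball_self (by linarith [hε (d n)])⟩,
    fun y ↦ ⟨Metric.ball y (ε y / 6), Metric.ball_mem_nhds _ (by linarith [hε y]), ?_⟩⟩
  rintro n m ⟨a, ha, han⟩ ⟨b, hb, hbm⟩
  by_contra hnm
  rw [Metric.mem_ball] at ha han hb hbm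
  have h1 := hsep n m hnm
  have h2 := hsep m n (Ne.symm hnm)
  have h3 : dist (d n) y ≤ dist a (d n) + dist a y := dist_triangle_left _ _ _
  have h4 : dist (d m) y ≤ dist b (d m) + dist b y := dist_triangle_left _ _ _
  have h5 : dist (d n) (d m) ≤ dist (d n) y + dist (d m) y := dist_triangle_right _ _ _
  rw [dist_comm (d m)] at h2
  have h6 := hε y
  exact hnm (hdε y n m (by linarith) (by linarith))

/-! ### The scheme -/

/-- One step of the construction of the scheme of open sets. -/
theorem exists_scheme_step {E F X : Type*} [MetricSpace X] [TopologicalSpace F] [MetrizableSpace F]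
    {f : E → F} (hsurj : Function.Surjective f) {h : X → F} (hh : Continuous h)
    (hbig : ∀ V : Set X, IsOpen V → V.Nonempty → ¬ IsCompact (closure (h '' V)))
    {V : Set X} (hV : IsOpen V) (hne : V.Nonempty) (U : Set E) {ε : ℝ} (hε : 0 < ε) :
    ∃ (Q : ℕ → Set X) (x : E), (∀ n, IsOpen (Q n) ∧ (Q n).Nonempty) ∧
      (∀ n, ∃ z, Q n ⊆ Metric.closedBall z ε ∧ closure (Q n) ⊆ V) ∧
      (∀ y, ∃ O ∈ 𝓝 y, ∀ n m, (O ∩ h '' Q n).Nonempty → (O ∩ h '' Q m).Nonempty → n = m) ∧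
      f x ∈ h '' Q 0 ∧ ∀ n, ∀ z ∈ Q n, ∀ e ∈ U, f e = h z → x ∈ U := by
  -- Either `h '' V'` misses `f '' U`, so that the condition on `U` is vacuous, or parameters with
  -- values in `f '' U` are dense in `V'`, so that `x` can be found in `U`.
  obtain ⟨V', hV', hne', hV'V, hdich⟩ : ∃ V' : Set X, IsOpen V' ∧ V'.Nonempty ∧ V' ⊆ V ∧
      ((∀ z ∈ V', ∀ e ∈ U, f e ≠ h z) ∨
        ∀ V'' ⊆ V', IsOpen V'' → V''.Nonempty → ∃ z ∈ V'', ∃ e ∈ U, f e = h z) := by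
    by_cases hc : ∃ V' ⊆ V, IsOpen V' ∧ V'.Nonempty ∧ ∀ z ∈ V', ∀ e ∈ U, f e ≠ h z
    · obtain ⟨V', h1, h2, h3, h4⟩ := hc
      exact ⟨V', h2, h3, h1, .inl h4⟩
    · push Not at hc
      exact ⟨V, hV, hne, Subset.rfl, .inr hc⟩
  obtain ⟨W, hWo, hWne, hWd⟩ := exists_discrete_open_family (hbig V' hV' hne')
  have hball : ∀ n, ∃ z r, 0 < r ∧ r ≤ ε ∧ Metric.closedBall z r ⊆ V' ∩ h ⁻¹' W n := fun n ↦ by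
    obtain ⟨_, ⟨z, hz, rfl⟩, hzW⟩ := hWne n
    obtain ⟨r, hr, hb⟩ := Metric.nhds_basis_closedBall.mem_iff.1
      ((hV'.inter ((hWo n).preimage hh)).mem_nhds ⟨hz, hzW⟩)
    exact ⟨z, min r ε, lt_min hr hε, min_le_right _ _,
      (Metric.closedBall_subset_closedBall (min_le_left _ _)).trans hb⟩
  choose z r hr hrε hb using hball
  have hQ : ∀ n, Metric.ball (z n) (r n) ⊆ V' ∩ h ⁻¹' W n := fun n ↦
    Metric.ball_subset_closedBall.trans (hb n)
  have hQW : ∀ n, h '' Metric.ball (z n) (r n) ⊆ W n := fun n ↦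
    image_subset_iff.2 fun a ha ↦ (hQ n ha).2
  obtain ⟨x, hx, hxU⟩ : ∃ x, f x ∈ h '' Metric.ball (z 0) (r 0) ∧
      ∀ n, ∀ a ∈ Metric.ball (z n) (r n), ∀ e ∈ U, f e = h a → x ∈ U := by
    rcases hdich with hd | hd
    · obtain ⟨x, hx⟩ := hsurj (h (z 0))
      exact ⟨x, ⟨z 0, Metric.mem_ball_self (hr 0), hx.symm⟩,
        fun n a ha e he hea ↦ absurd hea (hd a (hQ n ha).1 e he)⟩
    · obtain ⟨a, ha, x, hxU, hxa⟩ := hd _ (fun a ha ↦ (hQ 0 ha).1) Metric.isOpen_ball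
        ⟨z 0, Metric.mem_ball_self (hr 0)⟩
      exact ⟨x, ⟨a, ha, hxa.symm⟩, fun _ _ _ _ _ _ ↦ hxU⟩
  refine ⟨fun n ↦ Metric.ball (z n) (r n), x,
    fun n ↦ ⟨Metric.isOpen_ball, z n, Metric.mem_ball_self (hr n)⟩,
    fun n ↦ ⟨z n, Metric.ball_subset_closedBall.trans (Metric.closedBall_subset_closedBall (hrε n)),
      Metric.closure_ball_subset_closedBall.trans fun a ha ↦ hV'V (hb n ha).1⟩,
    fun y ↦ ?_, hx, hxU⟩
  obtain ⟨O, hO, hOd⟩ := hWd y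
  exact ⟨O, hO, fun n m hn hm ↦ hOd n m (hn.mono (inter_subset_inter_right _ (hQW n)))
    (hm.mono (inter_subset_inter_right _ (hQW m)))⟩

/-- A node of length `n` takes care of `U n`. Along a branch the sets in `X` shrink to a point `z`,
and `y = h z`. -/
theorem exists_scheme {E F X : Type*} [MetricSpace X] [CompleteSpace X] [Nonempty X]
    [TopologicalSpace F] [MetrizableSpace F]
    {f : E → F} (hsurj : Function.Surjective f) {h : X → F} (hh : Continuous h)
    (hbig : ∀ V : Set X, IsOpen V → V.Nonempty → ¬ IsCompact (closure (h '' V)))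
    (U : ℕ → Set E) :
    ∃ (H : List ℕ → Set F) (x : List ℕ → E),
      (∀ s, f (x s) ∈ H s) ∧ (∀ k s, H (k :: s) ⊆ H s) ∧
      (∀ s y, ∃ O ∈ 𝓝 y, (∀ k l, (O ∩ H (k :: s)).Nonempty → (O ∩ H (l :: s)).Nonempty → k = l) ∧
        (f (x s) ∈ O → ∀ k, ¬ (O ∩ H (k :: s)).Nonempty)) ∧
      ∀ α : ℕ → ℕ, ∃ y, ∀ n, ∀ e ∈ U n, f e = y → x (res α n) ∈ U n := by
  have : Nonempty E := ⟨(hsurj (h (Classical.arbitrary X))).choose⟩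
  choose! Q x hQ hQV hQd hx hxU using fun (V : Set X) (hV : IsOpen V ∧ V.Nonempty) (n : ℕ) ↦
    exists_scheme_step hsurj hh hbig hV.1 hV.2 (U n) (ε := (1 / 2 : ℝ) ^ n) (by positivity)
  -- The shift reserves `Q 0` for `f (x s)`, separating it from the children.
  let G : List ℕ → Set X := fun s ↦ List.rec univ (fun k s V ↦ Q V s.length (k + 1)) s
  have hG : ∀ k s, G (k :: s) = Q (G s) s.length (k + 1) := fun _ _ ↦ rfl
  have hGo : ∀ s, IsOpen (G s) ∧ (G s).Nonempty := fun s ↦ by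
    induction s with
    | nil => exact ⟨isOpen_univ, univ_nonempty⟩
    | cons k s ih => exact hQ _ ih _ _
  have hQG : ∀ s n, Q (G s) s.length n ⊆ G s := fun s n ↦
    subset_closure.trans (hQV _ (hGo s) s.length n).choose_spec.2
  refine ⟨fun s ↦ h '' G s, fun s ↦ x (G s) s.length,
    fun s ↦ image_mono (hQG s 0) (hx _ (hGo s) _), fun k s ↦ image_mono (hQG s _), fun s y ↦ ?_,
    fun α ↦ ?_⟩
  · obtain ⟨O, hO, hOd⟩ := hQd _ (hGo s) s.length y
    exact ⟨O, hO, fun k l hk hl ↦ Nat.succ_injective (hOd _ _ hk hl),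
      fun hxO k hk ↦ Nat.succ_ne_zero k (hOd _ _ hk ⟨_, hxO, hx _ (hGo s) _⟩)⟩
  · have hanti : Antitone fun n ↦ closure (G (res α n)) := antitone_nat_of_succ_le fun n ↦
      (hQV _ (hGo (res α n)) (res α n).length (α n + 1)).choose_spec.2.trans subset_closure
    have hball : ∀ n, ∃ z, closure (G (res α (n + 1))) ⊆ Metric.closedBall z ((1 / 2 : ℝ) ^ n) :=
      fun n ↦ by
        obtain ⟨z, hz, -⟩ := hQV _ (hGo (res α n)) (res α n).length (α n + 1)
        refine ⟨z, closure_minimal ?_ Metric.isClosed_closedBall⟩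
        rw [res_length] at hz
        rwa [res_succ, hG, res_length]
    choose c hc using hball
    choose w hw using fun n ↦ (hGo (res α (n + 1))).2
    have hwc : ∀ n m, n ≤ m → w m ∈ closure (G (res α (n + 1))) := fun n m hnm ↦
      hanti (Nat.succ_le_succ hnm) (subset_closure (hw m))
    have hw_cauchy : CauchySeq w := by
      refine cauchySeq_of_le_tendsto_0' (fun n ↦ (1 / 2 : ℝ) ^ n + (1 / 2 : ℝ) ^ n)
        (fun n m hnm ↦ ?_) ?_
      · exact (dist_triangle_right _ _ _).trans
          (add_le_add (hc n (hwc n n le_rfl)) (hc n (hwc n m hnm)))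
      · have := tendsto_pow_atTop_nhds_zero_of_lt_one (r := (1 / 2 : ℝ)) (by norm_num) (by norm_num)
        simpa using this.add this
    obtain ⟨z, hz⟩ := cauchySeq_tendsto_of_complete hw_cauchy
    have hzcl : ∀ n, z ∈ closure (G (res α (n + 1))) := fun n ↦
      isClosed_closure.mem_of_tendsto hz ((eventually_ge_atTop n).mono fun m hm ↦ hwc n m hm)
    have hzQ : ∀ n, z ∈ Q (G (res α n)) n (α n + 1) := fun n ↦ by
      have h1 := (hQV _ (hGo (res α (n + 1))) (res α (n + 1)).length
        (α (n + 1) + 1)).choose_spec.2 (hzcl (n + 1))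
      rwa [res_succ, hG, res_length] at h1
    refine ⟨h z, fun n e he hez ↦ ?_⟩
    change x (G (res α n)) (res α n).length ∈ U n
    rw [res_length]
    exact hxU _ (hGo _) n _ z (hzQ n) e he hez

/-! ### Local finiteness along well-founded trees -/

theorem mem_of_suffix {F : Type*} {H : List ℕ → Set F} {p : List ℕ → F} (hp : ∀ s, p s ∈ H s) (hH : ∀ k s, H (k :: s) ⊆ H s) {s t : List ℕ}
    (h : s <:+ t) : p t ∈ H s := by
  obtain ⟨r, rfl⟩ := h
  suffices ∀ r : List ℕ, H (r ++ s) ⊆ H s from this r (hp _)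
  intro r
  induction r with
  | nil => exact Subset.rfl
  | cons k r ih => exact (hH k _).trans ih

theorem eq_or_cons_suffix {s t : List ℕ} (h : s <:+ t) : t = s ∨ ∃ k, k :: s <:+ t := by
  obtain ⟨r, rfl⟩ := h
  rcases List.eq_nil_or_concat r with rfl | ⟨r, k, rfl⟩
  · exact .inl rfl
  · exact .inr ⟨k, r, by simp⟩

section Scheme

variable {F : Type*} [TopologicalSpace F] {H : List ℕ → Set F} {p : List ℕ → F}

theorem exists_nhds_finite_not_suffix_cons (hp : ∀ s, p s ∈ H s) (hH : ∀ k s, H (k :: s) ⊆ H s)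
    {y : F} {s : List ℕ} {O O' : Set F} (hO : O ∈ 𝓝 y) (hfin : {t | p t ∈ O ∧ ¬ s <:+ t}.Finite)
    (hO' : O' ∈ 𝓝 y) {k : ℕ} (hk : ∀ l, (O' ∩ H (l :: s)).Nonempty → l = k) :
    ∃ O ∈ 𝓝 y, {t | p t ∈ O ∧ ¬ k :: s <:+ t}.Finite := by
  refine ⟨O ∩ O', inter_mem hO hO', (hfin.union (finite_singleton s)).subset ?_⟩
  rintro t ⟨⟨ht, ht'⟩, hts⟩
  by_cases hst : s <:+ t
  · rcases eq_or_cons_suffix hst with rfl | ⟨l, hl⟩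
    · exact .inr rfl
    · exact absurd (hk l ⟨p t, ht', mem_of_suffix hp hH hl⟩ ▸ hl) hts
  · exact .inl ⟨ht, hst⟩

/-- Near `y` at most one child of each node is met, so one can descend level by level, losing only
finitely many indices. If no child is met, any child serves. -/
theorem exists_nhds_finite_not_suffix (hp : ∀ s, p s ∈ H s) (hH : ∀ k s, H (k :: s) ⊆ H s)
    (hd : ∀ s y, ∃ O ∈ 𝓝 y, ∀ k l, (O ∩ H (k :: s)).Nonempty → (O ∩ H (l :: s)).Nonempty → k = l)
    (y : F) (n : ℕ) :
    ∃ s : List ℕ, s.length = n ∧ ∃ O ∈ 𝓝 y, {t | p t ∈ O ∧ ¬ s <:+ t}.Finite := by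
  induction n with
  | zero => exact ⟨[], rfl, univ, univ_mem, by simp⟩
  | succ n ih =>
    obtain ⟨s, rfl, O, hO, hfin⟩ := ih
    obtain ⟨O', hO', hOd⟩ := hd s y
    by_cases hk : ∃ k, (O' ∩ H (k :: s)).Nonempty
    · obtain ⟨k, hk⟩ := hk
      exact ⟨k :: s, rfl,
        exists_nhds_finite_not_suffix_cons hp hH hO hfin hO' fun l hl ↦ hOd l k hl hk⟩
    · exact ⟨0 :: s, rfl,
        exists_nhds_finite_not_suffix_cons hp hH hO hfin hO' fun l hl ↦ absurd ⟨l, hl⟩ hk⟩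

theorem exists_nhds_finite_not_suffix_of_mem (hp : ∀ s, p s ∈ H s) (hH : ∀ k s, H (k :: s) ⊆ H s)
    (hd : ∀ s y, ∃ O ∈ 𝓝 y, ∀ k l, (O ∩ H (k :: s)).Nonempty → (O ∩ H (l :: s)).Nonempty → k = l)
    {y : F} {s : List ℕ} (hy : y ∈ H s) : ∃ O ∈ 𝓝 y, {t | p t ∈ O ∧ ¬ s <:+ t}.Finite := by
  induction s with
  | nil => exact ⟨univ, univ_mem, by simp⟩
  | cons k s ih =>
    obtain ⟨O, hO, hfin⟩ := ih (hH k s hy)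
    obtain ⟨O', hO', hOd⟩ := hd s y
    exact exists_nhds_finite_not_suffix_cons hp hH hO hfin hO' fun l hl ↦
      hOd l k hl ⟨y, mem_of_mem_nhds hO', hy⟩

theorem exists_nhds_self_finite (hp : ∀ s, p s ∈ H s) (hH : ∀ k s, H (k :: s) ⊆ H s)
    (hd : ∀ s y, ∃ O ∈ 𝓝 y, (∀ k l, (O ∩ H (k :: s)).Nonempty → (O ∩ H (l :: s)).Nonempty → k = l) ∧
      (p s ∈ O → ∀ k, ¬ (O ∩ H (k :: s)).Nonempty)) (s : List ℕ) :
    ∃ O ∈ 𝓝 (p s), {t | p t ∈ O}.Finite := by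
  obtain ⟨O, hO, hfin⟩ := exists_nhds_finite_not_suffix_of_mem hp hH
    (fun s y ↦ (hd s y).imp fun O h ↦ ⟨h.1, h.2.1⟩) (hp s)
  obtain ⟨O', hO', -, hOd⟩ := hd s (p s)
  refine ⟨O ∩ O', inter_mem hO hO', (hfin.union (finite_singleton s)).subset ?_⟩
  rintro t ⟨ht, ht'⟩
  by_cases hst : s <:+ t
  · rcases eq_or_cons_suffix hst with rfl | ⟨l, hl⟩
    · exact .inr rfl
    · exact absurd ⟨p t, ht', mem_of_suffix hp hH hl⟩ (hOd (mem_of_mem_nhds hO') l)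
  · exact .inl ⟨ht, hst⟩

/-- If infinitely many indices in `T` accumulated at `y`, any two of the nodes `σ n` would have a
common extension in `T`; the nodes would then form a branch of `T`. -/
theorem exists_nhds_finite_of_wellFounded (hp : ∀ s, p s ∈ H s) (hH : ∀ k s, H (k :: s) ⊆ H s)
    (hd : ∀ s y, ∃ O ∈ 𝓝 y, ∀ k l, (O ∩ H (k :: s)).Nonempty → (O ∩ H (l :: s)).Nonempty → k = l)
    {T : Set (List ℕ)} (hT : ∀ k s, k :: s ∈ T → s ∈ T) (hwf : ∀ α : ℕ → ℕ, ∃ n, res α n ∉ T)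
    (y : F) : ∃ O ∈ 𝓝 y, {t | t ∈ T ∧ p t ∈ O}.Finite := by
  by_contra! hinf
  choose σ hlen O hO hfin using exists_nhds_finite_not_suffix hp hH hd y
  have hcommon : ∀ n m, ∃ t ∈ T, σ n <:+ t ∧ σ m <:+ t := fun n m ↦ by
    by_contra! h
    refine hinf (O n ∩ O m) (inter_mem (hO n) (hO m)) (((hfin n).union (hfin m)).subset ?_)
    rintro t ⟨htT, htn, htm⟩
    by_cases hnt : σ n <:+ t
    · exact .inr ⟨htm, h t htT hnt⟩
    · exact .inl ⟨htn, hnt⟩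
  have hTsuff : ∀ {s t : List ℕ}, s <:+ t → t ∈ T → s ∈ T := by
    rintro s _ ⟨r, rfl⟩
    induction r with
    | nil => exact id
    | cons k r ih => exact fun h ↦ ih (hT k _ h)
  have hcons : ∀ n, ∃ k, σ (n + 1) = k :: σ n := fun n ↦ by
    obtain ⟨t, -, h1, h2⟩ := hcommon n (n + 1)
    obtain ⟨r, hr⟩ := List.suffix_of_suffix_length_le h1 h2 (by simp [hlen])
    have hl := congrArg List.length hr
    rw [List.length_append, hlen, hlen] at hl
    obtain ⟨k, rfl⟩ := List.length_eq_one_iff.1 (show r.length = 1 by omega)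
    exact ⟨k, hr.symm⟩
  choose α hα using hcons
  have hres : ∀ n, res α n = σ n := fun n ↦ by
    induction n with
    | zero => exact (List.length_eq_zero_iff.1 (hlen 0)).symm
    | succ n ih => rw [res_succ, ih, hα]
  obtain ⟨n, hn⟩ := hwf α
  obtain ⟨t, htT, ht, -⟩ := hcommon n n
  exact hn (hres n ▸ hTsuff ht htT)

end Scheme

/-! ### The part of the domain with large images -/

/-- A continuous image of a Polish space in a space that is not `σ`-compact contains the image of a
nonempty Polish subspace whose nonempty open subsets all have images with noncompact closure. -/
theorem exists_isClosed_forall_not_isCompact_closure_image {X F : Type*} [TopologicalSpace X]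
    [SecondCountableTopology X] [TopologicalSpace F] (hF : ¬ SigmaCompactSpace F)
    {h : X → F} (hsurj : Function.Surjective h) :
    ∃ Z : Set X, IsClosed Z ∧ Z.Nonempty ∧
      ∀ V : Set Z, IsOpen V → V.Nonempty → ¬ IsCompact (closure ((fun z : Z ↦ h z) '' V)) := by
  set 𝒱 : Set (Set X) := {V | IsOpen V ∧ ∃ K, IsSigmaCompact K ∧ h '' V ⊆ K} with h𝒱
  obtain ⟨𝒯, h𝒯c, h𝒯, hU⟩ := isOpen_sUnion_countable 𝒱 fun V hV ↦ hV.1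
  obtain ⟨K, hK, hUK⟩ : ∃ K, IsSigmaCompact K ∧ h '' ⋃₀ 𝒱 ⊆ K := by
    choose! K hK hVK using fun V (hV : V ∈ 𝒱) ↦ hV.2
    refine ⟨⋃ V ∈ 𝒯, K V, isSigmaCompact_biUnion h𝒯c fun V hV ↦ hK V (h𝒯 hV), ?_⟩
    rw [← hU]
    rintro _ ⟨z, ⟨V, hV, hz⟩, rfl⟩
    exact mem_biUnion hV (hVK V (h𝒯 hV) ⟨z, hz, rfl⟩)
  refine ⟨(⋃₀ 𝒱)ᶜ, (isOpen_sUnion fun V hV ↦ hV.1).isClosed_compl, ?_, ?_⟩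
  · by_contra! hempty
    rw [compl_empty_iff] at hempty
    rw [hempty, image_univ, hsurj.range_eq, univ_subset_iff] at hUK
    exact hF (isSigmaCompact_univ_iff.1 (hUK ▸ hK))
  · rintro V hV ⟨z, hz⟩ hc
    obtain ⟨V', hV', rfl⟩ := isOpen_induced_iff.1 hV
    -- Points of `V'` outside the kernel map into `K`, so a compact closure would put `V'` itself
    -- into `𝒱`.
    refine z.2 ⟨V', ⟨hV', ⋃₀ {closure ((fun z : ↥(⋃₀ 𝒱)ᶜ ↦ h z) '' (Subtype.val ⁻¹' V')), K},
      isSigmaCompact_sUnion _ (by simp) ?_, ?_⟩, hz⟩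
    · rintro ⟨A, rfl | rfl⟩
      exacts [hc.isSigmaCompact, hK]
    · rintro _ ⟨a, ha, rfl⟩
      by_cases haU : a ∈ ⋃₀ 𝒱
      · exact ⟨K, by simp, hUK ⟨a, haU, rfl⟩⟩
      · exact ⟨_, .inl rfl, subset_closure ⟨⟨a, haU⟩, ha, rfl⟩⟩

/-! ### The main theorem -/

theorem proposition3p1 {E F : Type*}
    [TopologicalSpace E] [TopologicalSpace.MetrizableSpace E]
    (hE : MeasureTheory.AnalyticSet (Set.univ : Set E))
    [TopologicalSpace F] [TopologicalSpace.MetrizableSpace F]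
    (hF : ¬ SigmaCompactSpace F)
    (f : E → F) (hf : Continuous f) (hsurj : Function.Surjective f) :
    ∃ S : Set E, IsDiscrete S ∧
      ∀ 𝒜 : Set (TopologicalSpace.Closeds E), IsSouslin (effrosBorel E) 𝒜 →
        (∀ A : TopologicalSpace.Closeds E, (A : Set E) ⊆ S → A ∈ 𝒜) →
        ∃ A ∈ 𝒜, ∃ y : F, f ⁻¹' {y} ⊆ (A : Set E) := by
  rw [AnalyticSet] at hE
  rcases hE with hE | ⟨g, hg, hgr⟩
  · have : IsEmpty E := univ_eq_empty_iff.1 hE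
    have : IsEmpty F := ⟨fun y ↦ isEmptyElim (hsurj y).choose⟩
    exact (hF inferInstance).elim
  have hgs : Function.Surjective g := range_eq_univ.1 hgr
  have : SeparableSpace E := hgs.denseRange.separableSpace hg
  have : SecondCountableTopology E := by
    let : MetricSpace E := metrizableSpaceMetric E
    exact UniformSpace.secondCountable_of_separable E
  obtain ⟨Z, hZ, hZne, hbig⟩ :=
    exists_isClosed_forall_not_isCompact_closure_image hF (hsurj.comp hgs)
  have : PolishSpace Z := hZ.polishSpace
  have : Nonempty Z := hZne.to_subtype
  let := upgradeIsCompletelyMetrizable Z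
  obtain ⟨U, hU⟩ := (countable_countableBasis E).exists_eq_range
    ((isBasis_countableBasis E).exists_subset_of_mem_open (mem_univ (g 0)) isOpen_univ |>.imp
      fun _ h ↦ h.1)
  obtain ⟨H, x, hx, hH, hd, hbranch⟩ := exists_scheme hsurj
    (h := fun z : Z ↦ (f ∘ g) z) ((hf.comp hg).comp continuous_subtype_val) hbig U
  have hd' : ∀ s y, ∃ O ∈ 𝓝 y,
      ∀ k l, (O ∩ H (k :: s)).Nonempty → (O ∩ H (l :: s)).Nonempty → k = l :=
    fun s y ↦ (hd s y).imp fun O h ↦ ⟨h.1, h.2.1⟩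
  refine ⟨range x, isDiscrete_iff_forall_mem_exists_isOpen.2 ?_, fun 𝒜 h𝒜 hS ↦ ?_⟩
  · rintro _ ⟨s, rfl⟩
    obtain ⟨O, hO, hfin⟩ := exists_nhds_self_finite hx hH hd s
    obtain ⟨O', hO'O, hO', hsO'⟩ := mem_nhds_iff.1 (hf.continuousAt.preimage_mem_nhds hO)
    refine ⟨O' \ (x '' {t | f (x t) ∈ O} \ {x s}),
      hO'.sdiff ((hfin.image x).subset sdiff_subset).isClosed, ?_⟩
    ext e
    constructor
    · rintro ⟨⟨he, hne⟩, t, rfl⟩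
      by_contra hts
      exact hne ⟨⟨t, hO'O he, rfl⟩, hts⟩
    · rintro rfl
      exact ⟨⟨hsO', by simp⟩, s, rfl⟩
  · have : PolishSpace Bool := {}
    have : PolishSpace (List ℕ → Bool) := inferInstance
    -- `T` need not be a tree; only its branch `α` is used.
    obtain ⟨T, hTB, α, hα⟩ :=
      ((h𝒜.preimage (measurable_closure_image x)).analyticSet).exists_illfounded_tree
        fun T hT hwf ↦ by
          refine hS _ ?_
          have hclosed : IsClosed (x '' {s | T s = true}) := by
            rw [← biUnion_of_singleton (x '' _), biUnion_image, biUnion_eq_iUnion]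
            refine LocallyFinite.isClosed_iUnion (fun e ↦ ?_) fun _ ↦ isClosed_singleton
            obtain ⟨O, hO, hfin⟩ := exists_nhds_finite_of_wellFounded hx hH hd'
              (T := {s | T s = true}) hT (fun α ↦ by simpa using hwf α) (f e)
            refine ⟨f ⁻¹' O, hf.continuousAt.preimage_mem_nhds hO,
              (hfin.preimage Subtype.val_injective.injOn).subset ?_⟩
            rintro t ⟨_, rfl, ht⟩
            exact ⟨t.2, ht⟩
          rw [Closeds.coe_closure, hclosed.closure_eq]
          exact image_subset_range _ _
    obtain ⟨y, hy⟩ := hbranch α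
    refine ⟨_, hTB, y, fun e he ↦ (isBasis_countableBasis E).mem_closure_iff.2 fun V hV heV ↦ ?_⟩
    obtain ⟨n, rfl⟩ : V ∈ range U := hU ▸ hV
    exact ⟨x (res α n), hy n e heV he, _, hα n, rfl⟩
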